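/- Let $(\Omega,\mathcal F,\mathbb P)$ be a probability space and $\mathcal G\subseteq\mathcal F$ a sub-$\sigma$-algebra; random variables are identified when they are equal $\mathbb P$-a.s., and (in)equalities are $\mathbb P$-a.s. unless another measure is indicated. Let $L_{\mathcal F}\subseteq L^0(\Omega,\mathcal F,\mathbb P)$ and $L_{\mathcal G}\subseteq L^0(\Omega,\mathcal G,\mathbb P)$ be vector lattices such that $X\mathbf 1_A\in L_{\mathcal F}$ for $X\in L_{\mathcal F}$, $A\in\mathcal F$, and $Y\mathbf 1_A\in L_{\mathcal G}$ for $Y\in L_{\mathcal G}$, $A\in\mathcal G$. Let $L_{\mathcal F}^*$ be the order continuous dual of $L_{\mathcal F}$, i.e. the space of linear functionals $\varphi:L_{\mathcal F}\to\mathbb R$ with $\varphi(x_\alpha)\to0$ for every net $(x_\alpha)$ that order converges to $0$ in $L_{\mathcal F}$. Assume that * $L_{\mathcal F}^*\subseteq L^1(\Omega,\mathcal F,\mathbb P)$, i.e. every $\varphi\in L^*_{\mathcal F}$ has the form $\varphi(\xi)=E_{\mathbb P}[Z\xi]$ (with $Z\xi$ integrable for all $\xi\in L_{\mathcal F}$)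 for some $Z\in L^1(\Omega,\mathcal F,\mathbb P)$; we write $Z\in L_{\mathcal F}^*$ for such $Z$; and $Z\mathbf 1_A\in L_{\mathcal F}^*$ whenever $Z\in L_{\mathcal F}^*$ and $A\in\mathcal F$; * $L_{\mathcal F}^*$ separates the points of $L_{\mathcal F}$. Let $\sigma(L_{\mathcal F},L_{\mathcal F}^*)$ be the corresponding weak topology, and let $L_{\mathcal F}^*\cap\mathcal P_{\mathcal G}$ be the set of probability measures $Q\ll\mathbb P$ on $\mathcal F$ with $\frac{dQ}{d\mathbb P}\in L_{\mathcal F}^*$ and $Q=\mathbb P$ on $\mathcal G$. Assume that this set is non-empty (which holds, for instance, if $L_{\mathcal F}\subseteq L^1(\Omega,\mathcal F,\mathbb P)$, since then it contains $\mathbb P$). Let $\pi:L_{\mathcal F}\to L_{\mathcal G}$ be * monotone: $X\le Y$ implies $\pi(X)\le\pi(Y)$; * quasiconvex: $\pi(\Lambda X+(1-\Lambda)Y)\le\pi(X)\vee\pi(Y)$ for all $X,Y\in L_{\mathcal F}$ and $\mathcal G$-measurable $0\le\Lambda\le1$ with $\Lambda X+(1-\Lambda)Y\in L_{\mathcal F}$;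 * regular: $\pi(X\mathbf 1_A+Y\mathbf 1_{A^C})=\pi(X)\mathbf 1_A+\pi(Y)\mathbf 1_{A^C}$ for all $X,Y\in L_{\mathcal F}$, $A\in\mathcal G$; * $\sigma(L_{\mathcal F},L_{\mathcal F}^*)$-lower semicontinuous: $\{\xi\in L_{\mathcal F}\mid\pi(\xi)\le Y\}$ is $\sigma(L_{\mathcal F},L_{\mathcal F}^*)$-closed for every $Y\in L_{\mathcal G}$. For $X\in L_{\mathcal F}$ and $Q\in L_{\mathcal F}^*\cap\mathcal P_{\mathcal G}$ define the extended real valued random variable $$K(X,Q):=\operatorname*{ess\,inf}_{\xi\in L_{\mathcal F}}\left\{\pi(\xi)\;\middle|\;E_Q[\xi\mid\mathcal G]\ge E_Q[X\mid\mathcal G]\ \ Q\text{-a.s.}\right\}.$$ Let $X\in L_{\mathcal F}$ and suppose there are $\eta\in L_{\mathcal F}$ and a real $\delta>0$ with $\mathbb P(\pi(\eta)+\delta<\pi(X))=1$. Then, $\mathbb P$-a.s., $$\pi(X)=\operatorname*{ess\,sup}_{Q\in L_{\mathcal F}^*\cap\mathcal P_{\mathcal G}}K(X,Q).$$ -/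

import Mathlib

open MeasureTheory Filter Topology

namespace QuasiconvexDual

universe u

/-! ### Essential suprema and infima of families of extended real random variables -/

section EssentialBounds

variable {Ω : Type u} [mΩ : MeasurableSpace Ω]

theorem exists_isLUB_of_countable (P : Measure Ω) {C : Set (Ω →ₘ[P] EReal)} (hC : C.Countable) :
    ∃ g, IsLUB C g := by
  rcases C.eq_empty_or_nonempty with rfl | hne
  · refine ⟨AEEqFun.const Ω ⊥, by simp, fun g _ => ?_⟩
    rw [← AEEqFun.coeFn_le]
    filter_upwards [AEEqFun.coeFn_const Ω (μ := P) (⊥ : EReal)] with ω h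
    rw [h]
    exact bot_le
  · obtain ⟨f, rfl⟩ := hC.exists_eq_range hne
    have hm : AEStronglyMeasurable (fun ω => ⨆ n, f n ω) P :=
      (Measurable.iSup fun n => (f n).measurable).aestronglyMeasurable
    refine ⟨AEEqFun.mk _ hm, ?_, fun g hg => ?_⟩
    · rintro _ ⟨n, rfl⟩
      rw [← AEEqFun.coeFn_le]
      filter_upwards [AEEqFun.coeFn_mk _ hm] with ω h
      rw [h]
      exact le_iSup (fun n => f n ω) n
    · rw [← AEEqFun.coeFn_le]
      have h2 : ∀ᵐ ω ∂P, ∀ n, f n ω ≤ g ω :=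
        ae_all_iff.2 fun n => AEEqFun.coeFn_le.2 (hg ⟨n, rfl⟩)
      filter_upwards [AEEqFun.coeFn_mk _ hm, h2] with ω h h2
      rw [h]
      exact iSup_le h2

/-- A strictly increasing map of the extended reals into `[0, 1]`. -/
noncomputable def squash (x : EReal) : ENNReal := (1 + EReal.exp (-x))⁻¹

theorem squash_strictMono : StrictMono squash := by
  intro x y h
  unfold squash
  rw [ENNReal.inv_lt_inv]
  exact ENNReal.add_lt_add_left (by simp) (EReal.exp_strictMono (EReal.neg_lt_neg_iff.2 h))

theorem squash_le_one (x : EReal) : squash x ≤ 1 := by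
  unfold squash
  rw [ENNReal.inv_le_one]
  exact le_self_add

/-- Every family of extended real random variables has an essential supremum. -/
theorem exists_isLUB (P : Measure Ω) [IsFiniteMeasure P] (S : Set (Ω →ₘ[P] EReal)) :
    ∃ g, IsLUB S g := by
  let J : (Ω →ₘ[P] EReal) → ENNReal := fun g => ∫⁻ ω, squash (g ω) ∂P
  have hJfin : ∀ g, J g ≠ ⊤ := fun g => by
    have : J g ≤ ∫⁻ _, 1 ∂P := lintegral_mono fun ω => squash_le_one _
    exact ne_top_of_le_ne_top (by simp) this
  have hJmono : ∀ {g g' : Ω →ₘ[P] EReal}, g ≤ g' → J g ≤ J g' := fun h =>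
    lintegral_mono_ae ((AEEqFun.coeFn_le.2 h).mono fun ω hω => squash_strictMono.monotone hω)
  have hJeq : ∀ {g g' : Ω →ₘ[P] EReal}, g ≤ g' → J g' ≤ J g → g' ≤ g := by
    intro g g' h h'
    have hmeas : Measurable fun ω => squash (g' ω) :=
      squash_strictMono.monotone.measurable.comp g'.measurable
    have := ae_eq_of_ae_le_of_lintegral_le
      ((AEEqFun.coeFn_le.2 h).mono fun ω hω => squash_strictMono.monotone hω)
      (hJfin g) hmeas.aemeasurable h'
    rw [← AEEqFun.coeFn_le]
    filter_upwards [this] with ω hω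
    exact (squash_strictMono.injective hω).ge
  let T : Set (Ω →ₘ[P] EReal) := {g | ∃ C ⊆ S, C.Countable ∧ IsLUB C g}
  have hT : (J '' T).Nonempty := by
    obtain ⟨g, hg⟩ := exists_isLUB_of_countable P (C := ∅) Set.countable_empty
    exact ⟨J g, g, ⟨∅, Set.empty_subset _, Set.countable_empty, hg⟩, rfl⟩
  obtain ⟨v, -, hv, hvT⟩ := exists_seq_tendsto_sSup hT (OrderTop.bddAbove _)
  choose w hwT hwv using hvT
  choose C hCS hCc hCw using hwT
  have hUc : (⋃ n, C n).Countable := Set.countable_iUnion hCc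
  obtain ⟨g, hg⟩ := exists_isLUB_of_countable P hUc
  have hgS : sSup (J '' T) ≤ J g := by
    refine le_of_tendsto' hv fun n => ?_
    rw [← hwv]
    exact hJmono ((hCw n).2 fun x hx => hg.1 (Set.mem_iUnion.2 ⟨n, hx⟩))
  refine ⟨g, fun h hh => ?_, fun b hb => hg.2 fun x hx => ?_⟩
  · obtain ⟨g', hg'⟩ := exists_isLUB_of_countable P (hUc.insert h)
    have h1 : g ≤ g' := hg.2 fun x hx => hg'.1 (Set.mem_insert_of_mem _ hx)
    have hg'T : g' ∈ T := ⟨_, Set.insert_subset hh (Set.iUnion_subset hCS), hUc.insert h, hg'⟩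
    have h2 : J g' ≤ J g := (le_sSup (Set.mem_image_of_mem J hg'T)).trans hgS
    exact (hg'.1 (Set.mem_insert _ _)).trans (hJeq h1 h2)
  · obtain ⟨n, hn⟩ := Set.mem_iUnion.1 hx
    exact hb (hCS n hn)

/-- The `P`-essential supremum of a family of extended real random variables: the least upper
bound for the `P`-almost sure order (`⊥` for the empty family). -/
noncomputable def esssup {P : Measure Ω} [IsFiniteMeasure P] (S : Set (Ω →ₘ[P] EReal)) :
    Ω →ₘ[P] EReal :=
  (exists_isLUB P S).choose

theorem isLUB_esssup {P : Measure Ω} [IsFiniteMeasure P] (S : Set (Ω →ₘ[P] EReal)) :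
    IsLUB S (esssup S) :=
  (exists_isLUB P S).choose_spec

/-- The `P`-essential infimum of a family of extended real random variables: the greatest lower
bound for the `P`-almost sure order (`⊤` for the empty family). -/
noncomputable def essinf {P : Measure Ω} [IsFiniteMeasure P] (S : Set (Ω →ₘ[P] EReal)) :
    Ω →ₘ[P] EReal :=
  esssup (lowerBounds S)

theorem isGLB_essinf {P : Measure Ω} [IsFiniteMeasure P] (S : Set (Ω →ₘ[P] EReal)) :
    IsGLB S (essinf S) :=
  isLUB_lowerBounds.1 (isLUB_esssup _)

/-- A real random variable regarded as an extended real one. -/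
noncomputable def toEReal {P : Measure Ω} (f : Ω →ₘ[P] ℝ) : Ω →ₘ[P] EReal :=
  AEEqFun.comp (fun r : ℝ => (r : EReal)) continuous_coe_real_ereal f

/-- The class of the indicator function of a measurable set. -/
noncomputable def ind (P : Measure Ω) (A : Set Ω) (hA : MeasurableSet A) : Ω →ₘ[P] ℝ :=
  AEEqFun.mk (A.indicator fun _ => (1 : ℝ)) (measurable_const.indicator hA).aestronglyMeasurable

end EssentialBounds

/-! ### Spaces of random variables -/

section Spaces

variable {Ω : Type u}

/-- `L` is a vector lattice of (classes of) `𝒢`-measurable random variables, and it is stable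
under multiplication by indicators of sets of `𝒢`. -/
structure IsRandomLattice (𝒢 : MeasurableSpace Ω) [mΩ : MeasurableSpace Ω] (h𝒢 : 𝒢 ≤ mΩ)
    {P : Measure Ω} (L : Submodule ℝ (Ω →ₘ[P] ℝ)) : Prop where
  measurable : ∀ f ∈ L, AEStronglyMeasurable[𝒢] f P
  sup_mem : ∀ f ∈ L, ∀ g ∈ L, f ⊔ g ∈ L
  inf_mem : ∀ f ∈ L, ∀ g ∈ L, f ⊓ g ∈ L
  mul_ind_mem : ∀ f ∈ L, ∀ (A : Set Ω) (hA : MeasurableSet[𝒢] A), f * ind P A (h𝒢 A hA) ∈ L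

variable [mΩ : MeasurableSpace Ω] {P : Measure Ω}

/-- Order convergence to `0` of a net in the ordered space `L`: the absolute values are dominated
by a net of `L` with the same index set that decreases to `0` in `L`. -/
def OrderTendstoZero (L : Submodule ℝ (Ω →ₘ[P] ℝ)) {ι : Type u} [Preorder ι] (x : ι → L) : Prop :=
  ∃ y : ι → L, Antitone y ∧ IsGLB (Set.range y) 0 ∧
    ∀ i, |(x i : Ω →ₘ[P] ℝ)| ≤ (y i : Ω →ₘ[P] ℝ)

/-- A linear functional is order continuous if it maps nets that order converge to `0` to nets
that converge to `0`. (Directed index sets in the universe of `Ω` are enough, since `L` itself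
lives in that universe.) -/
def IsOrderContinuous (L : Submodule ℝ (Ω →ₘ[P] ℝ)) (φ : L →ₗ[ℝ] ℝ) : Prop :=
  ∀ (ι : Type u) [Preorder ι] [IsDirectedOrder ι] [Nonempty ι] (x : ι → L),
    OrderTendstoZero L x → Tendsto (fun i => φ (x i)) atTop (𝓝 0)

/-- The order continuous dual of `L`. -/
def orderContinuousDual (L : Submodule ℝ (Ω →ₘ[P] ℝ)) : Submodule ℝ (L →ₗ[ℝ] ℝ) where
  carrier := {φ | IsOrderContinuous L φ}
  add_mem' := by
    intro φ ψ hφ hψ ι _ _ _ x hx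
    simpa using (hφ ι x hx).add (hψ ι x hx)
  zero_mem' := by
    intro ι _ _ _ x hx
    simp
  smul_mem' := by
    intro c φ hφ ι _ _ _ x hx
    simpa using (hφ ι x hx).const_mul c

/-- The weak topology on `L` induced by its order continuous dual. -/
abbrev weakTopology (L : Submodule ℝ (Ω →ₘ[P] ℝ)) : TopologicalSpace L :=
  TopologicalSpace.induced (fun (ξ : L) (φ : orderContinuousDual L) => φ.1 ξ) Pi.topologicalSpace

/-- `Z` represents the functional `φ` on `L`: `Z` is in `L¹(P)` and `φ ξ = E_P[Z ξ]` (with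
integrable product) for every `ξ` in `L`. -/
def Represents (L : Submodule ℝ (Ω →ₘ[P] ℝ)) (Z : Ω → ℝ) (φ : L →ₗ[ℝ] ℝ) : Prop :=
  Integrable Z P ∧ ∀ ξ : L, Integrable (fun ω => Z ω * (ξ : Ω →ₘ[P] ℝ) ω) P ∧
    φ ξ = ∫ ω, Z ω * (ξ : Ω →ₘ[P] ℝ) ω ∂P

/-- `Z`, as an element of `L¹(P)`, belongs to the order continuous dual of `L`. -/
def IsDualDensity (L : Submodule ℝ (Ω →ₘ[P] ℝ)) (Z : Ω → ℝ) : Prop :=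
  ∃ φ ∈ orderContinuousDual L, Represents L Z φ

end Spaces

/-! ### Conditional maps and the dual functional -/

section Maps

variable {Ω : Type u} (𝒢 : MeasurableSpace Ω) [mΩ : MeasurableSpace Ω] {P : Measure Ω}
  {LF LG : Submodule ℝ (Ω →ₘ[P] ℝ)}

/-- (QCO): `π (Λ X + (1 - Λ) Y) ≤ π X ∨ π Y` for `𝒢`-measurable `0 ≤ Λ ≤ 1`, whenever the
combination `W = Λ X + (1 - Λ) Y` belongs to the domain of `π`. -/
def IsCondQuasiconvex (π : LF → LG) : Prop :=
  ∀ (X Y W : LF) (Λ : Ω →ₘ[P] ℝ), AEStronglyMeasurable[𝒢] Λ P → 0 ≤ Λ → Λ ≤ 1 →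
    (W : Ω →ₘ[P] ℝ) = Λ * X + (1 - Λ) * Y →
      (π W : Ω →ₘ[P] ℝ) ≤ (π X : Ω →ₘ[P] ℝ) ⊔ (π Y : Ω →ₘ[P] ℝ)

/-- (REG): `π (X 1_A + Y 1_{Aᶜ}) = π X 1_A + π Y 1_{Aᶜ}` for `A` in `𝒢`. -/
def IsRegular (h𝒢 : 𝒢 ≤ mΩ) (π : LF → LG) : Prop :=
  ∀ (X Y W : LF) (A : Set Ω) (hA : MeasurableSet[𝒢] A),
    (W : Ω →ₘ[P] ℝ) = X * ind P A (h𝒢 A hA) + Y * ind P Aᶜ (h𝒢 A hA).compl →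
      (π W : Ω →ₘ[P] ℝ) = π X * ind P A (h𝒢 A hA) + π Y * ind P Aᶜ (h𝒢 A hA).compl

/-- (LSC): the sets `{π ≤ Y}`, `Y ∈ LG`, are closed in the weak topology of `LF`. -/
def IsWeakLSC (π : LF → LG) : Prop :=
  ∀ Y : LG, IsClosed[weakTopology LF] {X : LF | π X ≤ Y}

/-- `K(X, Q) = ess inf {π ξ | ξ ∈ LF, E_Q[ξ | 𝒢] ≥ E_Q[X | 𝒢] Q-a.s.}`. -/
noncomputable def K [IsFiniteMeasure P] (π : LF → LG) (X : LF) (Q : Measure Ω) : Ω →ₘ[P] EReal :=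
  essinf {k | ∃ ξ : LF, Q[((X : Ω →ₘ[P] ℝ) : Ω → ℝ)|𝒢] ≤ᵐ[Q] Q[((ξ : Ω →ₘ[P] ℝ) : Ω → ℝ)|𝒢] ∧
    k = toEReal (π ξ : Ω →ₘ[P] ℝ)}

/-- The probabilities `Q ≪ P` whose density `dQ/dP` lies in the order continuous dual of `LF`
and that coincide with `P` on `𝒢`. -/
def dualProbabilities (LF : Submodule ℝ (Ω →ₘ[P] ℝ)) : Set (Measure Ω) :=
  {Q | IsProbabilityMeasure Q ∧ Q ≪ P ∧ IsDualDensity LF (fun ω => (Q.rnDeriv P ω).toReal) ∧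
    ∀ A, MeasurableSet[𝒢] A → Q A = P A}

end Maps

end QuasiconvexDual

/-!
Only `π X ≤ ess sup_Q K(X, Q)` needs an argument. By quasiconvexity and lower semicontinuity the
sublevel set `{π ≤ Y}` is convex and weakly closed, so Hahn-Banach separates it from `X` by an order
continuous functional `E_P[Z ·]`, and monotonicity allows `Z ≥ 0`. By regularity the sublevel set is
stable under pasting along `𝒢`, which upgrades this to the conditional separation
`E_P[Z ξ | 𝒢] < E_P[Z X | 𝒢]` on one nonnull `V` in `𝒢`, for all `ξ` with `π ξ ≤ Y` simultaneously.
On a nonnull `D ⊆ V` where `E_P[Z | 𝒢] ≥ c > 0`, the density `Z / E_P[Z | 𝒢]` is normalized;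
completed off `D` by the density of any given dual probability, it defines a dual probability `Q`.
If `E_Q[ξ | 𝒢] ≥ E_Q[X | 𝒢]`, then `π ξ ≥ Y` on `D`, since otherwise pasting `ξ` into the sublevel
set would contradict the separation; thus `Y ≤ K(X, Q)` on `D`. Localizing this to subsets of
`{π η < π X}` and exhausting, then letting `Y ↑ π X`, gives the claim on every such set; where no
`η` does better than `X`, the bound `π X ≤ K(X, Q)` is trivial.
-/

namespace QuasiconvexDual

universe u

section MeasureTheory

variable {Ω : Type*} {𝒢 : MeasurableSpace Ω} [mΩ : MeasurableSpace Ω] {P Q : Measure Ω}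

theorem exists_monotone_seq_exhausting [SFinite P] {𝒜 : Set (Set Ω)} (hne : 𝒜.Nonempty)
    (hmeas : ∀ A ∈ 𝒜, MeasurableSet A) (hunion : ∀ A ∈ 𝒜, ∀ B ∈ 𝒜, A ∪ B ∈ 𝒜) :
    ∃ A : ℕ → Set Ω, Monotone A ∧ (∀ n, A n ∈ 𝒜) ∧ ∀ E ∈ 𝒜, E ≤ᵐ[P] ⋃ n, A n := by
  obtain ⟨𝒟, h𝒟𝒜, h𝒟, hsub⟩ := Measure.exists_ae_subset_biUnion_countable P hmeas
  obtain ⟨A₀, hA₀⟩ := hne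
  obtain ⟨S, hS⟩ := (h𝒟.insert A₀).exists_eq_range (Set.insert_nonempty _ _)
  have hS𝒜 : ∀ n, S n ∈ 𝒜 := fun n =>
    Set.insert_subset hA₀ h𝒟𝒜 (hS ▸ Set.mem_range_self n)
  refine ⟨Set.accumulate S, Set.monotone_accumulate, fun n => ?_, fun E hE => ?_⟩
  · induction n with
    | zero => simpa only [Set.accumulate_zero_nat] using hS𝒜 0
    | succ n ih => simpa only [Set.accumulate_succ] using hunion _ ih _ (hS𝒜 _)
  · rw [Set.iUnion_accumulate, ← Set.sUnion_range, ← hS]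
    exact (hsub E hE).trans (Set.sUnion_mono (Set.subset_insert _ _)).eventuallyLE

theorem ae_restrict_of_forall_exists_subset [SFinite P] (h𝒢 : 𝒢 ≤ mΩ) {p : Ω → Prop} {A : Set Ω}
    (hA : MeasurableSet[𝒢] A)
    (h : ∀ B ⊆ A, MeasurableSet[𝒢] B → P B ≠ 0 →
      ∃ D ⊆ B, MeasurableSet[𝒢] D ∧ P D ≠ 0 ∧ ∀ᵐ ω ∂P.restrict D, p ω) :
    ∀ᵐ ω ∂P.restrict A, p ω := by
  let 𝒜 : Set (Set Ω) := {D | MeasurableSet[𝒢] D ∧ ∀ᵐ ω ∂P.restrict D, p ω}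
  obtain ⟨D, -, hD, hexh⟩ := exists_monotone_seq_exhausting (P := P) (𝒜 := 𝒜)
    ⟨∅, @MeasurableSet.empty _ 𝒢, by simp⟩ (fun D hD => h𝒢 D hD.1)
    fun D hD E hE => ⟨hD.1.union hE.1, (ae_restrict_union_iff D E p).2 ⟨hD.2, hE.2⟩⟩
  have hAD : P (A \ ⋃ n, D n) = 0 := by
    by_contra hne
    obtain ⟨E, hEA, hE, hPE, hpE⟩ :=
      h _ Set.sdiff_subset (hA.diff (MeasurableSet.iUnion fun n => (hD n).1)) hne
    have hsub : P (E \ ⋃ n, D n) = 0 := ae_le_set.1 (hexh E ⟨hE, hpE⟩)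
    rw [(Set.disjoint_sdiff_left.mono_left hEA).sdiff_eq_left] at hsub
    exact hPE hsub
  exact ae_mono (Measure.restrict_mono_ae (ae_le_set.2 hAD))
    ((ae_restrict_iUnion_iff D p).2 fun n => (hD n).2)

theorem exists_measurableSet_ae_mem_iff_lt {f g : Ω → ℝ} (hf : AEStronglyMeasurable[𝒢] f P)
    (hg : AEStronglyMeasurable[𝒢] g P) :
    ∃ A, MeasurableSet[𝒢] A ∧ ∀ᵐ ω ∂P, ω ∈ A ↔ f ω < g ω := by
  obtain ⟨f', hf', hff'⟩ := hf
  obtain ⟨g', hg', hgg'⟩ := hg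
  refine ⟨{ω | f' ω < g' ω}, hf'.measurableSet_lt hg', ?_⟩
  filter_upwards [hff', hgg'] with ω hfω hgω
  rw [hfω, hgω]

theorem condExp_ae_eq_restrict_mul (h𝒢 : 𝒢 ≤ mΩ) [SigmaFinite (P.trim h𝒢)] {q f g : Ω → ℝ}
    (hq : StronglyMeasurable[𝒢] q) (hf : Integrable f P) (hg : Integrable g P) {D : Set Ω}
    (hD : MeasurableSet[𝒢] D) (h : g =ᵐ[P.restrict D] q * f) :
    P[g | 𝒢] =ᵐ[P.restrict D] q * P[f | 𝒢] := by
  have hind : D.indicator g =ᵐ[P] D.indicator q * f := by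
    filter_upwards [(ae_restrict_iff' (h𝒢 D hD)).1 h] with ω hω
    by_cases hωD : ω ∈ D
    · simp [hωD, hω hωD]
    · simp [hωD]
  have hmul : D.indicator P[g | 𝒢] =ᵐ[P] D.indicator q * P[f | 𝒢] :=
    calc D.indicator P[g | 𝒢] =ᵐ[P] P[D.indicator g | 𝒢] := (condExp_indicator hg hD).symm
      _ =ᵐ[P] P[D.indicator q * f | 𝒢] := condExp_congr_ae hind
      _ =ᵐ[P] D.indicator q * P[f | 𝒢] := condExp_mul_of_stronglyMeasurable_left
          (hq.indicator hD) ((hg.indicator (h𝒢 D hD)).congr hind) hf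
  refine (ae_restrict_iff' (h𝒢 D hD)).2 ?_
  filter_upwards [hmul] with ω hω hωD
  simpa [hωD] using hω

theorem condExp_ae_eq_restrict_congr (h𝒢 : 𝒢 ≤ mΩ) [SigmaFinite (P.trim h𝒢)] {f g : Ω → ℝ}
    (hf : Integrable f P) (hg : Integrable g P) {D : Set Ω} (hD : MeasurableSet[𝒢] D)
    (h : g =ᵐ[P.restrict D] f) : P[g | 𝒢] =ᵐ[P.restrict D] P[f | 𝒢] := by
  simpa only [one_mul] using
    condExp_ae_eq_restrict_mul h𝒢 stronglyMeasurable_one hf hg hD (by simpa only [one_mul] using h)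

theorem ae_eq_zero_of_condExp_nonpos (h𝒢 : 𝒢 ≤ mΩ) [SigmaFinite (P.trim h𝒢)] {Z : Ω → ℝ}
    (hZ : Integrable Z P) (hZ0 : 0 ≤ᵐ[P] Z) : ∀ᵐ ω ∂P, P[Z | 𝒢] ω ≤ 0 → Z ω = 0 := by
  let N : Set Ω := {ω | P[Z | 𝒢] ω ≤ 0}
  have hN : MeasurableSet[𝒢] N :=
    stronglyMeasurable_condExp.measurableSet_le stronglyMeasurable_const
  have hint : ∫ ω in N, Z ω ∂P = 0 := by
    refine le_antisymm ?_ (integral_nonneg_of_ae (ae_restrict_of_ae hZ0))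
    rw [← setIntegral_condExp h𝒢 hZ hN]
    exact setIntegral_nonpos (h𝒢 N hN) fun ω hω => hω
  rw [setIntegral_eq_zero_iff_of_nonneg_ae (ae_restrict_of_ae hZ0) hZ.integrableOn] at hint
  exact (ae_restrict_iff' (h𝒢 N hN)).1 hint

theorem trim_eq_trim_of_forall_measurableSet (h𝒢 : 𝒢 ≤ mΩ)
    (hQP : ∀ A, MeasurableSet[𝒢] A → Q A = P A) : Q.trim h𝒢 = P.trim h𝒢 :=
  @Measure.ext _ 𝒢 _ _ fun A hA => by
    rw [trim_measurableSet_eq h𝒢 hA, trim_measurableSet_eq h𝒢 hA, hQP A hA]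

theorem ae_le_of_ae_le_of_trim_eq (h𝒢 : 𝒢 ≤ mΩ) (htrim : Q.trim h𝒢 = P.trim h𝒢) {f g : Ω → ℝ}
    (hf : StronglyMeasurable[𝒢] f) (hg : StronglyMeasurable[𝒢] g) (h : f ≤ᵐ[Q] g) : f ≤ᵐ[P] g := by
  rw [← hf.ae_le_trim_iff h𝒢 hg] at h ⊢
  rwa [← htrim]

theorem condExp_ae_eq_condExp_rnDeriv_mul [SigmaFinite P] [IsFiniteMeasure Q] (h𝒢 : 𝒢 ≤ mΩ)
    [SigmaFinite (P.trim h𝒢)] (hac : Q ≪ P) (htrim : Q.trim h𝒢 = P.trim h𝒢) {f : Ω → ℝ}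
    (hf : Integrable f Q) :
    Q[f | 𝒢] =ᵐ[P] P[fun ω => (Q.rnDeriv P ω).toReal * f ω | 𝒢] := by
  have hm : StronglyMeasurable[𝒢] Q[f | 𝒢] := stronglyMeasurable_condExp
  refine ae_eq_condExp_of_forall_setIntegral_eq h𝒢
    ((integrable_toReal_rnDeriv_mul_iff hac).2 hf) (fun A _ _ => ?_) (fun A hA _ => ?_)
    hm.aestronglyMeasurable
  · refine (integrable_of_integrable_trim h𝒢 ?_).integrableOn
    exact htrim ▸ integrable_condExp.trim h𝒢 hm
  · rw [setIntegral_toReal_rnDeriv_mul hac (h𝒢 A hA), ← setIntegral_condExp h𝒢 hf hA,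
      setIntegral_trim h𝒢 hm hA, setIntegral_trim h𝒢 hm hA, htrim]

theorem condExp_rnDeriv_ae_eq_one [SigmaFinite P] [IsFiniteMeasure Q] (h𝒢 : 𝒢 ≤ mΩ)
    [SigmaFinite (P.trim h𝒢)] (hac : Q ≪ P) (htrim : Q.trim h𝒢 = P.trim h𝒢) :
    P[fun ω => (Q.rnDeriv P ω).toReal | 𝒢] =ᵐ[P] 1 := by
  have h := condExp_ae_eq_condExp_rnDeriv_mul h𝒢 hac htrim (integrable_const (1 : ℝ))
  simp only [mul_one, condExp_const h𝒢] at h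
  exact h.symm

theorem exists_pos_measure_inter_ne_zero {q : Ω → ℝ} {V : Set Ω} (hV : MeasurableSet V)
    (hPV : P V ≠ 0) (hq : ∀ᵐ ω ∂P.restrict V, 0 < q ω) :
    ∃ c > 0, P (V ∩ {ω | c ≤ q ω}) ≠ 0 := by
  by_contra! hnull
  have hall : ∀ᵐ ω ∂P, ∀ n : ℕ, ω ∉ V ∩ {ω | 1 / ((n : ℝ) + 1) ≤ q ω} :=
    ae_all_iff.2 fun n => measure_eq_zero_iff_ae_notMem.1 (hnull _ Nat.one_div_pos_of_nat)
  refine hPV (measure_eq_zero_iff_ae_notMem.2 ?_)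
  filter_upwards [(ae_restrict_iff' hV).1 hq, hall] with ω hω hωn hωV
  obtain ⟨n, hn⟩ := exists_nat_one_div_lt (hω hωV)
  exact hωn n ⟨hωV, hn.le⟩

theorem condExp_pos_of_condExp_mul_lt (h𝒢 : 𝒢 ≤ mΩ) [SigmaFinite (P.trim h𝒢)] {Z f g : Ω → ℝ}
    (hZ : Integrable Z P) (hZ0 : 0 ≤ᵐ[P] Z) (hf : Integrable (Z * f) P)
    (hg : Integrable (Z * g) P) {V : Set Ω}
    (hlt : ∀ᵐ ω ∂P.restrict V, P[Z * f | 𝒢] ω < P[Z * g | 𝒢] ω) :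
    ∀ᵐ ω ∂P.restrict V, 0 < P[Z | 𝒢] ω := by
  have hN : MeasurableSet[𝒢] {ω | P[Z | 𝒢] ω ≤ 0} :=
    stronglyMeasurable_condExp.measurableSet_le stronglyMeasurable_const
  have hZfg : Z * g =ᵐ[P.restrict {ω | P[Z | 𝒢] ω ≤ 0}] Z * f := by
    refine (ae_restrict_iff' (h𝒢 _ hN)).2 ?_
    filter_upwards [ae_eq_zero_of_condExp_nonpos h𝒢 hZ hZ0] with ω hω hωN
    rw [Pi.mul_apply, Pi.mul_apply, hω hωN, zero_mul, zero_mul]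
  filter_upwards [hlt, ae_restrict_of_ae
    ((ae_restrict_iff' (h𝒢 _ hN)).1 (condExp_ae_eq_restrict_congr h𝒢 hf hg hN hZfg))]
    with ω hltω heq
  by_contra! hle
  exact hltω.ne' (heq hle)

theorem le_essinf_restrict [IsFiniteMeasure P] {S : Set (Ω →ₘ[P] EReal)} {Y : Ω →ₘ[P] EReal}
    {D : Set Ω} (hD : MeasurableSet D)
    (h : ∀ k ∈ S, Y ≤ᵐ[P.restrict D] k) : Y ≤ᵐ[P.restrict D] essinf S := by
  classical
  have hm : AEStronglyMeasurable (D.piecewise (Y : Ω → EReal) fun _ => ⊥) P :=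
    (Y.measurable.piecewise hD measurable_const).aestronglyMeasurable
  have hle : AEEqFun.mk _ hm ≤ essinf S := by
    refine (isGLB_essinf S).2 fun k hk => AEEqFun.coeFn_le.1 ?_
    filter_upwards [AEEqFun.coeFn_mk _ hm, (ae_restrict_iff' hD).1 (h k hk)] with ω hmk hYk
    rw [hmk]
    by_cases hω : ω ∈ D
    · simpa [hω] using hYk hω
    · simp [hω]
  refine (ae_restrict_iff' hD).2 ?_
  filter_upwards [AEEqFun.coeFn_mk _ hm, AEEqFun.coeFn_le.2 hle] with ω hmk hω hωD
  simpa [hmk, hωD] using hω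

theorem ae_le_of_forall_nat_ae_convexComb_le {f g : Ω → ℝ} {G : Ω → EReal}
    (h : ∀ n : ℕ, ∀ᵐ ω ∂P, ((f ω + 1 / ((n : ℝ) + 1) * (g ω - f ω) : ℝ) : EReal) ≤ G ω) :
    ∀ᵐ ω ∂P, (f ω : EReal) ≤ G ω := by
  filter_upwards [ae_all_iff.2 h] with ω hω
  have hlim : Tendsto (fun n : ℕ => f ω + 1 / ((n : ℝ) + 1) * (g ω - f ω)) atTop (𝓝 (f ω)) := by
    simpa using (tendsto_one_div_add_atTop_nhds_zero_nat.mul_const (g ω - f ω)).const_add (f ω)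
  exact le_of_tendsto' ((continuous_coe_real_ereal.tendsto _).comp hlim) hω

theorem coeFn_toEReal (f : Ω →ₘ[P] ℝ) : toEReal f =ᵐ[P] fun ω => (f ω : EReal) :=
  AEEqFun.coeFn_comp _ continuous_coe_real_ereal f

theorem coeFn_add_smul_sub (f g : Ω →ₘ[P] ℝ) (t : ℝ) :
    ⇑(f + t • (g - f)) =ᵐ[P] fun ω => f ω + t * (g ω - f ω) := by
  filter_upwards [AEEqFun.coeFn_add f (t • (g - f)), AEEqFun.coeFn_smul t (g - f),
    AEEqFun.coeFn_sub g f] with ω hadd hsmul hsub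
  rw [hadd, Pi.add_apply, hsmul, Pi.smul_apply, hsub, Pi.sub_apply, smul_eq_mul]

end MeasureTheory

section Functionals

variable {Ω : Type u} [mΩ : MeasurableSpace Ω] {P : Measure Ω} {L : Submodule ℝ (Ω →ₘ[P] ℝ)}

theorem coeFn_nonneg {β : Type*} [TopologicalSpace β] [Preorder β] [Zero β] {f : Ω →ₘ[P] β}
    (hf : 0 ≤ f) : 0 ≤ᵐ[P] f :=
  AEEqFun.coeFn_zero.symm.le.trans (AEEqFun.coeFn_le.2 hf)

theorem coeFn_abs_le {f g : Ω →ₘ[P] ℝ} (h : |f| ≤ g) : ∀ᵐ ω ∂P, |f ω| ≤ g ω := by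
  filter_upwards [AEEqFun.coeFn_abs f, AEEqFun.coeFn_le.2 h] with ω habs hle
  rwa [habs] at hle

theorem exists_orderContinuous_separating {C : Set L} (hconv : Convex ℝ C)
    (hclosed : IsClosed[weakTopology L] C) {x : L} (hx : x ∉ C) :
    ∃ φ ∈ orderContinuousDual L, ∃ u : ℝ, (∀ a ∈ C, φ a < u) ∧ u < φ x := by
  let T : L →ₗ[ℝ] orderContinuousDual L → ℝ := LinearMap.pi fun φ => φ.1
  let : TopologicalSpace L := weakTopology L
  have : IsTopologicalAddGroup L := topologicalAddGroup_induced T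
  have : ContinuousSMul ℝ L := continuousSMul_induced T
  have : LocallyConvexSpace ℝ L := LocallyConvexSpace.induced T
  obtain ⟨φ, u, hφC, hux⟩ := geometric_hahn_banach_closed_point hconv hclosed hx
  refine ⟨(φ : L →ₗ[ℝ] ℝ), fun ι _ _ _ y hy => ?_, u, hφC, hux⟩
  have hy0 : Tendsto y atTop (𝓝 0) := by
    rw [nhds_induced, tendsto_comap_iff, tendsto_pi_nhds]
    intro ψ
    simpa using ψ.2 ι y hy
  have hφ0 := (φ.continuous.tendsto 0).comp hy0
  rwa [map_zero] at hφ0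

/-- The functional `ξ ↦ E_P[Z ξ]` represented by `Z`. Integrability of every `Z ξ` is required
because the integral of a non-integrable function is the junk value `0`, which would destroy
additivity. -/
noncomputable def integralFunctional (Z : Ω → ℝ)
    (hZ : ∀ ξ : L, Integrable (fun ω => Z ω * ξ.1 ω) P) : L →ₗ[ℝ] ℝ where
  toFun ξ := ∫ ω, Z ω * ξ.1 ω ∂P
  map_add' ξ ζ := by
    rw [← integral_add (hZ ξ) (hZ ζ)]
    refine integral_congr_ae ?_
    filter_upwards [AEEqFun.coeFn_add ξ.1 ζ.1] with ω hω
    rw [Submodule.coe_add, hω, Pi.add_apply, mul_add]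
  map_smul' a ξ := by
    rw [RingHom.id_apply, smul_eq_mul, ← integral_const_mul]
    refine integral_congr_ae ?_
    filter_upwards [AEEqFun.coeFn_smul a ξ.1] with ω hω
    rw [Submodule.coe_smul, hω, Pi.smul_apply, smul_eq_mul, mul_left_comm]

theorem OrderTendstoZero.exists_tendsto_zero {φ : L →ₗ[ℝ] ℝ} (hφ : φ ∈ orderContinuousDual L)
    {ι : Type u} [Preorder ι] [IsDirectedOrder ι] [Nonempty ι] {x : ι → L}
    (hx : OrderTendstoZero L x) :
    ∃ y : ι → L, (∀ i, |(x i).1| ≤ (y i).1) ∧ Tendsto (fun i => φ (y i)) atTop (𝓝 0) := by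
  obtain ⟨y, hanti, hinf, hxy⟩ := hx
  refine ⟨y, hxy, hφ ι y ⟨y, hanti, hinf, fun i => AEEqFun.coeFn_le.1 ?_⟩⟩
  filter_upwards [coeFn_nonneg (hinf.1 ⟨i, rfl⟩), AEEqFun.coeFn_abs (y i).1] with ω h0 habs
  rw [habs, abs_of_nonneg h0]

theorem Represents.congr {Z Z' : Ω → ℝ} {φ : L →ₗ[ℝ] ℝ} (h : Represents L Z φ)
    (hZ : Z =ᵐ[P] Z') : Represents L Z' φ := by
  have hmul : ∀ ξ : L, (fun ω => Z ω * ξ.1 ω) =ᵐ[P] fun ω => Z' ω * ξ.1 ω := fun ξ =>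
    hZ.mul (EventuallyEq.refl _ _)
  exact ⟨h.1.congr hZ, fun ξ =>
    ⟨(h.2 ξ).1.congr (hmul ξ), (h.2 ξ).2.trans (integral_congr_ae (hmul ξ))⟩⟩

theorem IsDualDensity.integrable {Z : Ω → ℝ} (hZ : IsDualDensity L Z) : Integrable Z P :=
  hZ.choose_spec.2.1

theorem IsDualDensity.integrable_mul {Z : Ω → ℝ} (hZ : IsDualDensity L Z) (ξ : L) :
    Integrable (fun ω => Z ω * ξ.1 ω) P :=
  (hZ.choose_spec.2.2 ξ).1

theorem IsDualDensity.congr {Z Z' : Ω → ℝ} (h : IsDualDensity L Z) (hZ : Z =ᵐ[P] Z') :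
    IsDualDensity L Z' :=
  let ⟨φ, hφ, hrep⟩ := h
  ⟨φ, hφ, hrep.congr hZ⟩

theorem IsDualDensity.add {Z Z' : Ω → ℝ} (hZ : IsDualDensity L Z) (hZ' : IsDualDensity L Z') :
    IsDualDensity L (Z + Z') := by
  obtain ⟨φ, hφ, hZ, hZξ⟩ := hZ
  obtain ⟨ψ, hψ, hZ', hZ'ξ⟩ := hZ'
  refine ⟨φ + ψ, add_mem hφ hψ, hZ.add hZ', fun ξ => ?_⟩
  simp only [Pi.add_apply, add_mul, LinearMap.add_apply]
  exact ⟨(hZξ ξ).1.add (hZ'ξ ξ).1,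
    by rw [integral_add (hZξ ξ).1 (hZ'ξ ξ).1, (hZξ ξ).2, (hZ'ξ ξ).2]⟩

theorem IsDualDensity.const_smul {Z : Ω → ℝ} (hZ : IsDualDensity L Z) (c : ℝ) :
    IsDualDensity L (c • Z) := by
  obtain ⟨φ, hφ, hZ, hZξ⟩ := hZ
  refine ⟨c • φ, Submodule.smul_mem _ c hφ, hZ.smul c, fun ξ => ?_⟩
  simp only [Pi.smul_apply, smul_eq_mul, mul_assoc, LinearMap.smul_apply]
  exact ⟨(hZξ ξ).1.const_mul c, by rw [integral_const_mul, (hZξ ξ).2]⟩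

theorem IsDualDensity.of_abs_le {Z Z' : Ω → ℝ} (hZ : IsDualDensity L Z)
    (hZ' : AEStronglyMeasurable Z' P) (hle : ∀ᵐ ω ∂P, |Z' ω| ≤ Z ω) : IsDualDensity L Z' := by
  have hint : ∀ ξ : L, Integrable (fun ω => Z' ω * ξ.1 ω) P := fun ξ => by
    refine (hZ.integrable_mul ξ).mono (hZ'.mul ξ.1.aestronglyMeasurable) ?_
    filter_upwards [hle] with ω hω
    rw [norm_mul, norm_mul]
    exact mul_le_mul_of_nonneg_right (hω.trans (le_abs_self _)) (norm_nonneg _)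
  obtain ⟨φ, hφ, hZint, hZφ⟩ := hZ
  refine ⟨integralFunctional Z' hint, fun ι _ _ _ x hx => ?_,
    hZint.mono' hZ' hle, fun ξ => ⟨hint ξ, rfl⟩⟩
  obtain ⟨y, hxy, hy⟩ := hx.exists_tendsto_zero hφ
  refine squeeze_zero_norm (fun i => ?_) hy
  rw [(hZφ (y i)).2]
  refine norm_integral_le_of_norm_le (hZφ (y i)).1 ?_
  filter_upwards [hle, coeFn_abs_le (hxy i)] with ω hω hxyω
  rw [norm_mul]
  exact mul_le_mul hω hxyω (norm_nonneg _) ((abs_nonneg _).trans hω)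

end Functionals

section Pasting

variable {Ω : Type u} {𝒢 : MeasurableSpace Ω} [mΩ : MeasurableSpace Ω] {P : Measure Ω}
  {LF LG : Submodule ℝ (Ω →ₘ[P] ℝ)}

theorem coeFn_mul_ind (f : Ω →ₘ[P] ℝ) {A : Set Ω} (hA : MeasurableSet A) :
    f * ind P A hA =ᵐ[P] A.indicator f := by
  filter_upwards [AEEqFun.coeFn_mul f (ind P A hA), AEEqFun.coeFn_mk (μ := P)
    (A.indicator fun _ => (1 : ℝ)) (measurable_const.indicator hA).aestronglyMeasurable]
    with ω hmul hind
  rw [hmul, Pi.mul_apply, ind, hind, ← Set.indicator_mul_right A f fun _ => (1 : ℝ)]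
  simp only [mul_one]

open scoped Classical in
theorem coeFn_mul_ind_add_mul_ind_compl (f g : Ω →ₘ[P] ℝ) {A : Set Ω} (hA : MeasurableSet A)
    (hAc : MeasurableSet Aᶜ) :
    (f * ind P A hA + g * ind P Aᶜ hAc : Ω →ₘ[P] ℝ) =ᵐ[P] A.piecewise f g := by
  rw [← Set.indicator_add_compl_eq_piecewise]
  exact (AEEqFun.coeFn_add _ _).trans ((coeFn_mul_ind f hA).add (coeFn_mul_ind g hAc))

open scoped Classical in
theorem IsRegular.exists_piecewise {h𝒢 : 𝒢 ≤ mΩ} {π : LF → LG} (hREG : IsRegular 𝒢 h𝒢 π)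
    (hLF : IsRandomLattice mΩ le_rfl LF) (ξ ζ : LF) {A : Set Ω} (hA : MeasurableSet[𝒢] A) :
    ∃ W : LF, W.1 =ᵐ[P] A.piecewise ξ.1 ζ.1 ∧ (π W).1 =ᵐ[P] A.piecewise (π ξ).1 (π ζ).1 := by
  have hAΩ := h𝒢 A hA
  let W : LF := ⟨ξ.1 * ind P A hAΩ + ζ.1 * ind P Aᶜ hAΩ.compl,
    LF.add_mem (hLF.mul_ind_mem _ ξ.2 A hAΩ) (hLF.mul_ind_mem _ ζ.2 Aᶜ hAΩ.compl)⟩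
  refine ⟨W, coeFn_mul_ind_add_mul_ind_compl _ _ _ _, ?_⟩
  rw [hREG ξ ζ W A hA rfl]
  exact coeFn_mul_ind_add_mul_ind_compl _ _ _ _

open scoped Classical in
/-- A set of random variables is stable under pasting if `1_A ξ + 1_{Aᶜ} ζ` belongs to it whenever
`ξ` and `ζ` do and `A` is in `𝒢`. -/
def IsPasteStable (𝒢 : MeasurableSpace Ω) (C : Set LF) : Prop :=
  ∀ ξ ∈ C, ∀ ζ ∈ C, ∀ A, MeasurableSet[𝒢] A → ∃ W ∈ C, W.1 =ᵐ[P] A.piecewise ξ.1 ζ.1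

theorem IsRegular.isPasteStable_sublevel {h𝒢 : 𝒢 ≤ mΩ} {π : LF → LG} (hREG : IsRegular 𝒢 h𝒢 π)
    (hLF : IsRandomLattice mΩ le_rfl LF) (Y : LG) : IsPasteStable 𝒢 {ξ : LF | π ξ ≤ Y} := by
  classical
  intro ξ hξ ζ hζ A hA
  obtain ⟨W, hW, hπ⟩ := hREG.exists_piecewise hLF ξ ζ hA
  refine ⟨W, AEEqFun.coeFn_le.1 ?_, hW⟩
  filter_upwards [hπ, AEEqFun.coeFn_le.2 hξ, AEEqFun.coeFn_le.2 hζ] with ω hω hξω hζω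
  rw [hω]
  by_cases hωA : ω ∈ A
  · rwa [Set.piecewise_eq_of_mem _ _ _ hωA]
  · rwa [Set.piecewise_eq_of_notMem _ _ _ hωA]

end Pasting

section Positivity

variable {Ω : Type u} [mΩ : MeasurableSpace Ω] {P : Measure Ω} {LF : Submodule ℝ (Ω →ₘ[P] ℝ)}

theorem nonneg_of_forall_lt_of_sublevel {β : Type*} [Preorder β] {π : LF → β}
    (hMON : Monotone π) {Y : β} {η : LF} (hη : π η ≤ Y) {φ : LF →ₗ[ℝ] ℝ} {u : ℝ}
    (hφ : ∀ ξ, π ξ ≤ Y → φ ξ < u) {ξ : LF} (hξ : 0 ≤ ξ.1) : 0 ≤ φ ξ := by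
  by_contra! hneg
  obtain ⟨n, hn⟩ := exists_nat_ge ((u - φ η) / -φ ξ)
  have hle : η - (n : ℝ) • ξ ≤ η := by
    refine AEEqFun.coeFn_le.1 ?_
    rw [Submodule.coe_sub, Submodule.coe_smul]
    filter_upwards [AEEqFun.coeFn_sub η.1 ((n : ℝ) • ξ.1), AEEqFun.coeFn_smul (n : ℝ) ξ.1,
      coeFn_nonneg hξ] with ω hsub hsmul h0
    rw [hsub, Pi.sub_apply, hsmul]
    exact sub_le_self _ (mul_nonneg n.cast_nonneg h0)
  have hlt := hφ _ ((hMON hle).trans hη)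
  rw [map_sub, map_smul, smul_eq_mul] at hlt
  rw [div_le_iff₀ (neg_pos.2 hneg)] at hn
  linarith

theorem Represents.mul_abs_nonneg (hLF : IsRandomLattice mΩ le_rfl LF) {Z : Ω → ℝ}
    {φ : LF →ₗ[ℝ] ℝ} (hZ : Represents LF Z φ) (hφ : ∀ ξ : LF, 0 ≤ ξ.1 → 0 ≤ φ ξ) (ξ : LF) :
    0 ≤ᵐ[P] fun ω => Z ω * |ξ.1 ω| := by
  let ζ : LF := ⟨|ξ.1|, hLF.sup_mem _ ξ.2 _ (LF.neg_mem ξ.2)⟩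
  have hζ : (fun ω => Z ω * ζ.1 ω) =ᵐ[P] fun ω => Z ω * |ξ.1 ω| :=
    (EventuallyEq.refl _ Z).mul (AEEqFun.coeFn_abs ξ.1)
  refine ae_nonneg_of_forall_setIntegral_nonneg ((hZ.2 ζ).1.congr hζ) fun A hA _ => ?_
  let W : LF := ⟨ζ.1 * ind P A hA, hLF.mul_ind_mem _ ζ.2 A hA⟩
  have hW : W.1 =ᵐ[P] A.indicator fun ω => |ξ.1 ω| :=
    (coeFn_mul_ind ζ.1 hA).trans (AEEqFun.coeFn_abs ξ.1).indicator
  have hW0 : 0 ≤ W.1 := by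
    refine AEEqFun.coeFn_le.1 (AEEqFun.coeFn_zero.le.trans ?_)
    filter_upwards [hW] with ω hω
    rw [hω]
    exact Set.indicator_nonneg (fun _ _ => abs_nonneg _) ω
  calc 0 ≤ φ W := hφ W hW0
    _ = ∫ ω, Z ω * W.1 ω ∂P := (hZ.2 W).2
    _ = ∫ ω, A.indicator (fun ω => Z ω * |ξ.1 ω|) ω ∂P := by
      refine integral_congr_ae ?_
      filter_upwards [hW] with ω hω
      rw [hω, Set.indicator_mul_right]
    _ = ∫ ω in A, Z ω * |ξ.1 ω| ∂P := integral_indicator hA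

-- Positivity of `φ` does not control the sign of `Z` where all of `LF` vanishes, so `Z ≥ 0` fails
-- in general; but there, replacing `Z` by `Z⁺` does not change `φ`.
theorem Represents.posPart (hLF : IsRandomLattice mΩ le_rfl LF) {Z : Ω → ℝ} {φ : LF →ₗ[ℝ] ℝ}
    (hZ : Represents LF Z φ) (hφ : ∀ ξ : LF, 0 ≤ ξ.1 → 0 ≤ φ ξ) :
    Represents LF (fun ω => max (Z ω) 0) φ := by
  have hmul : ∀ ξ : LF, (fun ω => Z ω * ξ.1 ω) =ᵐ[P] fun ω => max (Z ω) 0 * ξ.1 ω := by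
    intro ξ
    filter_upwards [hZ.mul_abs_nonneg hLF hφ ξ] with ω hω
    rcases eq_or_ne (ξ.1 ω) 0 with h0 | h0
    · rw [h0, mul_zero, mul_zero]
    · rw [max_eq_left (nonneg_of_mul_nonneg_left hω (abs_pos.2 h0))]
  exact ⟨hZ.1.pos_part, fun ξ =>
    ⟨(hZ.2 ξ).1.congr (hmul ξ), (hZ.2 ξ).2.trans (integral_congr_ae (hmul ξ))⟩⟩

end Positivity

section Quasiconvexity

variable {Ω : Type u} {𝒢 : MeasurableSpace Ω} [mΩ : MeasurableSpace Ω] {P : Measure Ω}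
  {LF LG : Submodule ℝ (Ω →ₘ[P] ℝ)}

theorem const_mul_eq_smul (a : ℝ) (f : Ω →ₘ[P] ℝ) : AEEqFun.const Ω a * f = a • f :=
  AEEqFun.induction_on f fun _ _ => rfl

theorem IsCondQuasiconvex.quasiconvexOn {π : LF → LG} (hQCO : IsCondQuasiconvex 𝒢 π) :
    QuasiconvexOn ℝ Set.univ π := by
  intro Y ξ hξ ζ hζ a b ha hb hab
  have hcomb : (a • ξ + b • ζ : LF).1 =
      AEEqFun.const Ω a * ξ.1 + (1 - AEEqFun.const Ω a) * ζ.1 := by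
    have hb' : (1 - AEEqFun.const Ω a : Ω →ₘ[P] ℝ) = AEEqFun.const Ω b := by
      rw [← sub_eq_of_eq_add' hab.symm]
      rfl
    rw [hb', const_mul_eq_smul, const_mul_eq_smul]
    rfl
  refine ⟨trivial, (hQCO ξ ζ _ _ ?_ ?_ ?_ hcomb).trans (sup_le hξ.2 hζ.2)⟩
  · exact aestronglyMeasurable_const.congr (AEEqFun.coeFn_const Ω a).symm
  · exact (AEEqFun.mk_le_mk _ _).2 (.of_forall fun _ => ha)
  · exact (AEEqFun.mk_le_mk _ _).2 (.of_forall fun _ => hab ▸ le_add_of_nonneg_right hb)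

end Quasiconvexity

section ConditionalSeparation

variable {Ω : Type u} {𝒢 : MeasurableSpace Ω} [mΩ : MeasurableSpace Ω] {P : Measure Ω}
  {LF : Submodule ℝ (Ω →ₘ[P] ℝ)} {Z : Ω → ℝ} {φ : LF →ₗ[ℝ] ℝ} {C : Set LF} {x : LF} {u : ℝ}

/-- The sets of `𝒢` on which `E_P[Z x | 𝒢] ≤ E_P[Z ξ | 𝒢]` for some `ξ` in `C`. The conditional
separation of `x` from `C` takes place on the complement of their essential union. -/
def dominatedSets (𝒢 : MeasurableSpace Ω) (Z : Ω → ℝ) (C : Set LF) (x : LF) : Set (Set Ω) :=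
  {A | MeasurableSet[𝒢] A ∧ ∃ ξ ∈ C, P[Z * ⇑x.1 | 𝒢] ≤ᵐ[P.restrict A] P[Z * ⇑ξ.1 | 𝒢]}

open scoped Classical in
theorem condExp_mul_piecewise_ae_eq [IsFiniteMeasure P] (h𝒢 : 𝒢 ≤ mΩ)
    (hZ : ∀ ξ : LF, Integrable (fun ω => Z ω * ξ.1 ω) P) {W ξ ζ : LF} {A : Set Ω}
    (hA : MeasurableSet[𝒢] A) (hW : W.1 =ᵐ[P] A.piecewise ξ.1 ζ.1) :
    P[Z * ⇑W.1 | 𝒢] =ᵐ[P.restrict A] P[Z * ⇑ξ.1 | 𝒢] ∧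
      P[Z * ⇑W.1 | 𝒢] =ᵐ[P.restrict Aᶜ] P[Z * ⇑ζ.1 | 𝒢] := by
  have hAΩ := h𝒢 A hA
  have hξ : W.1 =ᵐ[P.restrict A] ξ.1 :=
    (hW.filter_mono ae_restrict_le).trans (piecewise_ae_eq_restrict hAΩ)
  have hζ : W.1 =ᵐ[P.restrict Aᶜ] ζ.1 :=
    (hW.filter_mono ae_restrict_le).trans (piecewise_ae_eq_restrict_compl hAΩ)
  exact ⟨condExp_ae_eq_restrict_congr h𝒢 (hZ ξ) (hZ W) hA ((EventuallyEq.refl _ Z).mul hξ),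
    condExp_ae_eq_restrict_congr h𝒢 (hZ ζ) (hZ W) hA.compl ((EventuallyEq.refl _ Z).mul hζ)⟩

theorem union_mem_dominatedSets [IsFiniteMeasure P] (h𝒢 : 𝒢 ≤ mΩ)
    (hZ : ∀ ξ : LF, Integrable (fun ω => Z ω * ξ.1 ω) P) (hC : IsPasteStable 𝒢 C) {A B : Set Ω}
    (hA : A ∈ dominatedSets 𝒢 Z C x) (hB : B ∈ dominatedSets 𝒢 Z C x) :
    A ∪ B ∈ dominatedSets 𝒢 Z C x := by
  obtain ⟨hA, ξ, hξ, hAξ⟩ := hA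
  obtain ⟨hB, ζ, hζ, hBζ⟩ := hB
  obtain ⟨W, hWC, hW⟩ := hC ξ hξ ζ hζ A hA
  obtain ⟨hWξ, hWζ⟩ := condExp_mul_piecewise_ae_eq h𝒢 hZ hA hW
  have hBA : P[Z * ⇑x.1 | 𝒢] ≤ᵐ[P.restrict (B \ A)] P[Z * ⇑ζ.1 | 𝒢] :=
    hBζ.filter_mono (ae_mono (Measure.restrict_mono_set P Set.sdiff_subset))
  refine ⟨hA.union hB, W, hWC, ?_⟩
  rw [← Set.union_sdiff_self]
  refine (ae_restrict_union_iff _ _ _).2 ⟨hAξ.trans hWξ.symm.le, ?_⟩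
  exact hBA.trans (hWζ.filter_mono
    (ae_mono (Measure.restrict_mono_set P (Set.sdiff_subset_compl B A)))).symm.le

theorem Represents.sub_le_setIntegral_compl [IsFiniteMeasure P] (h𝒢 : 𝒢 ≤ mΩ)
    (hZ : Represents LF Z φ) (hC : IsPasteStable 𝒢 C) (hu : ∀ ξ ∈ C, φ ξ ≤ u) {η : LF}
    (hη : η ∈ C) {A : Set Ω} (hA : A ∈ dominatedSets 𝒢 Z C x) :
    φ x - u ≤ ∫ ω in Aᶜ, (Z * ⇑x.1 - Z * ⇑η.1) ω ∂P := by
  obtain ⟨hA, ξ, hξ, hAξ⟩ := hA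
  obtain ⟨W, hWC, hW⟩ := hC ξ hξ η hη A hA
  obtain ⟨hWξ, hWη⟩ := condExp_mul_piecewise_ae_eq h𝒢 (fun ξ => (hZ.2 ξ).1) hA hW
  have hx := (hZ.2 x).1
  have hWint := (hZ.2 W).1
  have hIA : ∫ ω in A, Z ω * x.1 ω ∂P ≤ ∫ ω in A, Z ω * W.1 ω ∂P := by
    rw [← setIntegral_condExp h𝒢 hx hA, ← setIntegral_condExp h𝒢 hWint hA]
    exact setIntegral_mono_ae_restrict integrable_condExp.integrableOn
      integrable_condExp.integrableOn (hAξ.trans hWξ.symm.le)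
  have hIAc : ∫ ω in Aᶜ, Z ω * W.1 ω ∂P = ∫ ω in Aᶜ, Z ω * η.1 ω ∂P := by
    rw [← setIntegral_condExp h𝒢 hWint hA.compl, ← setIntegral_condExp h𝒢 (hZ.2 η).1 hA.compl]
    exact integral_congr_ae hWη
  calc φ x - u ≤ φ x - φ W := sub_le_sub_left (hu W hWC) _
    _ = ∫ ω in A, Z ω * x.1 ω ∂P + ∫ ω in Aᶜ, Z ω * x.1 ω ∂P -
        (∫ ω in A, Z ω * W.1 ω ∂P + ∫ ω in Aᶜ, Z ω * W.1 ω ∂P) := by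
      rw [(hZ.2 x).2, (hZ.2 W).2, integral_add_compl (h𝒢 A hA) hx,
        integral_add_compl (h𝒢 A hA) hWint]
    _ ≤ ∫ ω in Aᶜ, Z ω * x.1 ω ∂P - ∫ ω in Aᶜ, Z ω * η.1 ω ∂P := by linarith
    _ = ∫ ω in Aᶜ, (Z * ⇑x.1 - Z * ⇑η.1) ω ∂P :=
      (integral_sub hx.integrableOn (hZ.2 η).1.integrableOn).symm

theorem Represents.exists_condExp_lt [IsFiniteMeasure P] (h𝒢 : 𝒢 ≤ mΩ)
    (hZ : Represents LF Z φ) (hC : IsPasteStable 𝒢 C) (hne : C.Nonempty) (hu : ∀ ξ ∈ C, φ ξ ≤ u)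
    (hux : u < φ x) :
    ∃ V, MeasurableSet[𝒢] V ∧ P V ≠ 0 ∧
      ∀ ξ ∈ C, ∀ᵐ ω ∂P.restrict V, P[Z * ⇑ξ.1 | 𝒢] ω < P[Z * ⇑x.1 | 𝒢] ω := by
  obtain ⟨η, hη⟩ := hne
  obtain ⟨A, hmono, hA, hexh⟩ := exists_monotone_seq_exhausting (P := P)
    (𝒜 := dominatedSets 𝒢 Z C x) ⟨∅, @MeasurableSet.empty _ 𝒢, η, hη, by simp [EventuallyLE]⟩
    (fun A hA => h𝒢 A hA.1)
    fun A hA B hB => union_mem_dominatedSets h𝒢 (fun ξ => (hZ.2 ξ).1) hC hA hB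
  have hUA : MeasurableSet[𝒢] (⋃ n, A n) := MeasurableSet.iUnion fun n => (hA n).1
  refine ⟨(⋃ n, A n)ᶜ, hUA.compl, fun hnull => ?_, fun ξ hξ => ?_⟩
  · let h : Ω → ℝ := Z * ⇑x.1 - Z * ⇑η.1
    have hint : Integrable h P := (hZ.2 x).1.sub (hZ.2 η).1
    have hlim : Tendsto (fun n => ∫ ω in (A n)ᶜ, h ω ∂P) atTop
        (𝓝 (∫ ω in ⋂ n, (A n)ᶜ, h ω ∂P)) :=
      tendsto_setIntegral_of_antitone (fun n => (h𝒢 _ (hA n).1).compl)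
        (fun m n hmn => Set.compl_subset_compl.2 (hmono hmn)) ⟨0, hint.integrableOn⟩
    rw [← Set.compl_iUnion, setIntegral_measure_zero _ hnull] at hlim
    have := ge_of_tendsto' hlim fun n => hZ.sub_le_setIntegral_compl h𝒢 hC hu hη (hA n)
    linarith
  · let E : Set Ω := (⋃ n, A n)ᶜ ∩ {ω | P[Z * ⇑x.1 | 𝒢] ω ≤ P[Z * ⇑ξ.1 | 𝒢] ω}
    have hE : MeasurableSet[𝒢] E := hUA.compl.inter
      (stronglyMeasurable_condExp.measurableSet_le stronglyMeasurable_condExp)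
    have hEA := hexh E ⟨hE, ξ, hξ, (ae_restrict_iff' (h𝒢 E hE)).2 (.of_forall fun ω hω => hω.2)⟩
    refine (ae_restrict_iff' (h𝒢 _ hUA.compl)).2 ?_
    filter_upwards [hEA] with ω hω hωA
    by_contra! hle
    exact hωA (hω ⟨hωA, hle⟩)

end ConditionalSeparation

section DualProbabilities

variable {Ω : Type u} {𝒢 : MeasurableSpace Ω} [mΩ : MeasurableSpace Ω] {P : Measure Ω}
  {LF : Submodule ℝ (Ω →ₘ[P] ℝ)}

theorem IsDualDensity.exists_mem_dualProbabilities [IsProbabilityMeasure P] (h𝒢 : 𝒢 ≤ mΩ)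
    {Z : Ω → ℝ} (hZ : IsDualDensity LF Z) (hZ0 : 0 ≤ᵐ[P] Z) (hZ1 : P[Z | 𝒢] =ᵐ[P] 1) :
    ∃ Q ∈ dualProbabilities 𝒢 LF, (fun ω => (Q.rnDeriv P ω).toReal) =ᵐ[P] Z := by
  have hint := hZ.integrable
  let Q : Measure Ω := P.withDensity fun ω => ENNReal.ofReal (Z ω)
  have hrn : (fun ω => (Q.rnDeriv P ω).toReal) =ᵐ[P] Z := by
    filter_upwards [Measure.rnDeriv_withDensity₀ P hint.1.aemeasurable.ennreal_ofReal, hZ0]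
      with ω hω h0
    rw [hω, ENNReal.toReal_ofReal h0]
  have hQP : ∀ A, MeasurableSet[𝒢] A → Q A = P A := fun A hA => by
    rw [withDensity_apply _ (h𝒢 A hA), ← ofReal_integral_eq_lintegral_ofReal hint.integrableOn
      (ae_restrict_of_ae hZ0), ← setIntegral_condExp h𝒢 hint hA,
      integral_congr_ae (ae_restrict_of_ae hZ1)]
    simp
  refine ⟨Q, ⟨⟨?_⟩, withDensity_absolutelyContinuous _ _, hZ.congr hrn.symm, hQP⟩, hrn⟩
  rw [hQP _ MeasurableSet.univ, measure_univ]

open scoped Classical in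
theorem IsDualDensity.piecewise_div {Z Z₀ q : Ω → ℝ} (hZ : IsDualDensity LF Z) (hZ0 : 0 ≤ᵐ[P] Z)
    (hZ₀ : IsDualDensity LF Z₀) (hZ₀0 : 0 ≤ᵐ[P] Z₀) (hq : AEMeasurable q P) {D : Set Ω}
    (hD : MeasurableSet D) {c : ℝ} (hc : 0 < c) (hcD : ∀ ω ∈ D, c ≤ q ω) :
    IsDualDensity LF (D.piecewise (Z / q) Z₀) := by
  have hm : AEStronglyMeasurable (D.piecewise (Z / q) Z₀) P :=
    .piecewise hD (hZ.integrable.aemeasurable.div hq).aestronglyMeasurable.restrict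
      hZ₀.integrable.aestronglyMeasurable.restrict
  refine ((hZ.const_smul c⁻¹).add hZ₀).of_abs_le hm ?_
  filter_upwards [hZ0, hZ₀0] with ω hω h₀
  rw [Pi.add_apply, Pi.smul_apply, smul_eq_mul, inv_mul_eq_div]
  by_cases hωD : ω ∈ D
  · rw [Set.piecewise_eq_of_mem _ _ _ hωD, Pi.div_apply,
      abs_of_nonneg (div_nonneg hω (hc.le.trans (hcD ω hωD)))]
    exact (div_le_div_of_nonneg_left hω hc (hcD ω hωD)).trans (le_add_of_nonneg_right h₀)
  · rw [Set.piecewise_eq_of_notMem _ _ _ hωD, abs_of_nonneg h₀]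
    exact le_add_of_nonneg_left (div_nonneg hω hc.le)

theorem IsDualDensity.exists_normalized [IsFiniteMeasure P] (h𝒢 : 𝒢 ≤ mΩ) {Z Z₀ : Ω → ℝ}
    (hZ : IsDualDensity LF Z) (hZ0 : 0 ≤ᵐ[P] Z) (hZ₀ : IsDualDensity LF Z₀) (hZ₀0 : 0 ≤ᵐ[P] Z₀)
    (hZ₀1 : P[Z₀ | 𝒢] =ᵐ[P] 1) {D : Set Ω} (hD : MeasurableSet[𝒢] D) {c : ℝ} (hc : 0 < c)
    (hcD : ∀ ω ∈ D, c ≤ P[Z | 𝒢] ω) :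
    ∃ Z', IsDualDensity LF Z' ∧ 0 ≤ᵐ[P] Z' ∧ P[Z' | 𝒢] =ᵐ[P] 1 ∧
      Z =ᵐ[P.restrict D] P[Z | 𝒢] * Z' := by
  classical
  have hDΩ := h𝒢 D hD
  let q : Ω → ℝ := P[Z | 𝒢]
  have hq : StronglyMeasurable[𝒢] q := stronglyMeasurable_condExp
  let Z' : Ω → ℝ := D.piecewise (Z / q) Z₀
  have hZ'D : Z =ᵐ[P.restrict D] q * Z' := by
    refine (ae_restrict_iff' hDΩ).2 (.of_forall fun ω hω => ?_)
    have hqω : q ω ≠ 0 := (hc.trans_le (hcD ω hω)).ne'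
    simp [Z', hω, mul_div_cancel₀ _ hqω]
  have hZ'0 : 0 ≤ᵐ[P] Z' := by
    filter_upwards [hZ0, hZ₀0] with ω hω h₀
    by_cases hωD : ω ∈ D
    · simpa [Z', hωD] using div_nonneg hω (hc.le.trans (hcD ω hωD))
    · simpa [Z', hωD] using h₀
  have hZ' : IsDualDensity LF Z' := hZ.piecewise_div hZ0 hZ₀ hZ₀0
    (hq.mono h𝒢).measurable.aemeasurable hDΩ hc hcD
  refine ⟨Z', hZ', hZ'0, ?_, hZ'D⟩
  have h1D : P[Z' | 𝒢] =ᵐ[P.restrict D] 1 := by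
    filter_upwards [condExp_ae_eq_restrict_mul h𝒢 hq hZ'.integrable hZ.integrable hD hZ'D,
      ae_restrict_mem hDΩ] with ω hω hωD
    exact mul_left_cancel₀ (hc.trans_le (hcD ω hωD)).ne' (hω.symm.trans (mul_one _).symm)
  have h1Dc : P[Z' | 𝒢] =ᵐ[P.restrict Dᶜ] 1 :=
    (condExp_ae_eq_restrict_congr h𝒢 hZ₀.integrable hZ'.integrable hD.compl
      (piecewise_ae_eq_restrict_compl hDΩ)).trans (ae_restrict_of_ae hZ₀1)
  exact ae_of_ae_restrict_of_ae_restrict_compl D h1D h1Dc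

theorem IsDualDensity.exists_condExp_mul_eq [IsProbabilityMeasure P] (h𝒢 : 𝒢 ≤ mΩ)
    {Z : Ω → ℝ} (hZ : IsDualDensity LF Z) (hZ0 : 0 ≤ᵐ[P] Z)
    (hne : (dualProbabilities 𝒢 LF).Nonempty) {D : Set Ω} (hD : MeasurableSet[𝒢] D) {c : ℝ}
    (hc : 0 < c) (hcD : ∀ ω ∈ D, c ≤ P[Z | 𝒢] ω) :
    ∃ Q ∈ dualProbabilities 𝒢 LF, ∀ ξ : LF,
      P[Z * ⇑ξ.1 | 𝒢] =ᵐ[P.restrict D] P[Z | 𝒢] * Q[ξ.1 | 𝒢] := by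
  obtain ⟨Q₀, _, hQ₀P, hQ₀, hQ₀𝒢⟩ := hne
  obtain ⟨Z', hZ', hZ'0, hZ'1, hZZ'⟩ := hZ.exists_normalized h𝒢 hZ0 hQ₀
    (.of_forall fun _ => ENNReal.toReal_nonneg)
    (condExp_rnDeriv_ae_eq_one h𝒢 hQ₀P (trim_eq_trim_of_forall_measurableSet h𝒢 hQ₀𝒢)) hD hc hcD
  obtain ⟨Q, hQ, hQZ'⟩ := hZ'.exists_mem_dualProbabilities h𝒢 hZ'0 hZ'1
  have ⟨_, hQP, hQdual, hQ𝒢⟩ := hQ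
  refine ⟨Q, hQ, fun ξ => ?_⟩
  have hQξ : Q[ξ.1 | 𝒢] =ᵐ[P] P[Z' * ⇑ξ.1 | 𝒢] :=
    (condExp_ae_eq_condExp_rnDeriv_mul h𝒢 hQP (trim_eq_trim_of_forall_measurableSet h𝒢 hQ𝒢)
      ((integrable_toReal_rnDeriv_mul_iff hQP).1 (hQdual.integrable_mul ξ))).trans
      (condExp_congr_ae (hQZ'.mul (EventuallyEq.refl _ _)))
  have hmul : P[Z * ⇑ξ.1 | 𝒢] =ᵐ[P.restrict D] P[Z | 𝒢] * P[Z' * ⇑ξ.1 | 𝒢] := by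
    refine condExp_ae_eq_restrict_mul h𝒢 stronglyMeasurable_condExp (hZ'.integrable_mul ξ)
      (hZ.integrable_mul ξ) hD ?_
    filter_upwards [hZZ'] with ω hω
    rw [hω, Pi.mul_apply, Pi.mul_apply, mul_assoc]
  exact hmul.trans ((EventuallyEq.refl _ _).mul (ae_restrict_of_ae hQξ.symm))

end DualProbabilities

section LocalDuality

variable {Ω : Type u} {𝒢 : MeasurableSpace Ω} [mΩ : MeasurableSpace Ω] {P : Measure Ω}
  [IsProbabilityMeasure P] {LF LG : Submodule ℝ (Ω →ₘ[P] ℝ)} {h𝒢 : 𝒢 ≤ mΩ} {π : LF → LG}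
  {X η : LF} {Y : LG}

theorem IsRegular.ae_le_of_condExp_mul_le (hREG : IsRegular 𝒢 h𝒢 π)
    (hLF : IsRandomLattice mΩ le_rfl LF) (hLG : ∀ f ∈ LG, AEStronglyMeasurable[𝒢] f P)
    (hη : π η ≤ Y) {Z : Ω → ℝ} (hZ : ∀ ξ : LF, Integrable (fun ω => Z ω * ξ.1 ω) P) {D : Set Ω}
    (hD : MeasurableSet[𝒢] D)
    (hlt : ∀ ξ, π ξ ≤ Y → ∀ᵐ ω ∂P.restrict D, P[Z * ⇑ξ.1 | 𝒢] ω < P[Z * ⇑X.1 | 𝒢] ω)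
    {ξ : LF} (hξ : P[Z * ⇑X.1 | 𝒢] ≤ᵐ[P.restrict D] P[Z * ⇑ξ.1 | 𝒢]) :
    Y.1 ≤ᵐ[P.restrict D] (π ξ).1 := by
  classical
  obtain ⟨A, hA, hAlt⟩ := exists_measurableSet_ae_mem_iff_lt (hLG _ (π ξ).2) (hLG _ Y.2)
  obtain ⟨W, hW, hπW⟩ := hREG.exists_piecewise hLF ξ η (hD.inter hA)
  have hWY : π W ≤ Y := by
    refine AEEqFun.coeFn_le.1 ?_
    filter_upwards [hπW, hAlt, AEEqFun.coeFn_le.2 hη] with ω hωW hωA hωη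
    rw [hωW, Set.piecewise]
    split_ifs with hω
    · exact (hωA.1 hω.2).le
    · exact hωη
  have hWξ := (condExp_mul_piecewise_ae_eq h𝒢 hZ (hD.inter hA) hW).1
  rw [EventuallyEq, ae_restrict_iff' (h𝒢 _ (hD.inter hA))] at hWξ
  filter_upwards [ae_restrict_of_ae hAlt, ae_restrict_of_ae hWξ, hξ, hlt W hWY,
    ae_restrict_mem (h𝒢 D hD)] with ω hωA hωW hωξ hωlt hωD
  by_contra! hω
  exact hωlt.not_ge (hωξ.trans_eq (hωW ⟨hωD, hωA.2 hω⟩).symm)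

theorem ae_le_esssup_K_of_forall_le {Q : Measure Ω} (hQ : Q ∈ dualProbabilities 𝒢 LF) {D : Set Ω}
    (hD : MeasurableSet D) {y : Ω →ₘ[P] ℝ}
    (h : ∀ ξ : LF, Q[X.1 | 𝒢] ≤ᵐ[Q] Q[ξ.1 | 𝒢] → y ≤ᵐ[P.restrict D] (π ξ).1) :
    ∀ᵐ ω ∂P.restrict D,
      (y ω : EReal) ≤ esssup {k | ∃ Q ∈ dualProbabilities 𝒢 LF, k = K 𝒢 π X Q} ω := by
  have hy := ae_restrict_of_ae (s := D) (coeFn_toEReal y)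
  have hyK : toEReal y ≤ᵐ[P.restrict D] K 𝒢 π X Q := by
    refine le_essinf_restrict hD ?_
    rintro _ ⟨ξ, hξ, rfl⟩
    filter_upwards [h ξ hξ, hy, ae_restrict_of_ae (coeFn_toEReal (π ξ).1)] with ω hle hωy hωξ
    rw [hωy, hωξ]
    exact EReal.coe_le_coe_iff.2 hle
  have hK : K 𝒢 π X Q ≤ esssup {k | ∃ Q ∈ dualProbabilities 𝒢 LF, k = K 𝒢 π X Q} :=
    (isLUB_esssup _).1 ⟨Q, hQ, rfl⟩
  filter_upwards [hyK, hy, ae_restrict_of_ae (AEEqFun.coeFn_le.2 hK)] with ω hωK hωy hle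
  exact hωy.symm.trans_le (hωK.trans hle)

section Separation

variable (hLF : IsRandomLattice mΩ le_rfl LF)
  (hdual : ∀ φ ∈ orderContinuousDual LF, ∃ Z : Ω → ℝ, Represents LF Z φ) (hMON : Monotone π)
  (hQCO : QuasiconvexOn ℝ Set.univ π) (hREG : IsRegular 𝒢 h𝒢 π) (hLSC : IsWeakLSC π)

include hLF hdual hMON hQCO hREG hLSC

theorem exists_dualDensity_separating (hη : π η ≤ Y) (hX : ¬ π X ≤ Y) :
    ∃ Z, IsDualDensity LF Z ∧ 0 ≤ᵐ[P] Z ∧ ∃ V, MeasurableSet[𝒢] V ∧ P V ≠ 0 ∧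
      ∀ ξ, π ξ ≤ Y → ∀ᵐ ω ∂P.restrict V, P[Z * ⇑ξ.1 | 𝒢] ω < P[Z * ⇑X.1 | 𝒢] ω := by
  have hconv : Convex ℝ {ξ | π ξ ≤ Y} := by simpa using hQCO Y
  obtain ⟨φ, hφ, u, hu, huX⟩ := exists_orderContinuous_separating hconv (hLSC Y) hX
  obtain ⟨Z, hZ⟩ := hdual φ hφ
  have hZpos := hZ.posPart hLF fun ξ => nonneg_of_forall_lt_of_sublevel hMON hη hu
  exact ⟨_, ⟨φ, hφ, hZpos⟩, .of_forall fun _ => le_max_right _ _,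
    hZpos.exists_condExp_lt h𝒢 (hREG.isPasteStable_sublevel hLF Y) ⟨η, hη⟩
      (fun ξ hξ => (hu ξ hξ).le) huX⟩

theorem exists_dualDensity_separating_on (hη : π η ≤ Y) {B : Set Ω} (hB : MeasurableSet[𝒢] B)
    (hPB : P B ≠ 0) (hYX : ∀ᵐ ω ∂P.restrict B, Y.1 ω < (π X).1 ω) :
    ∃ Z, IsDualDensity LF Z ∧ 0 ≤ᵐ[P] Z ∧ ∃ V ⊆ B, MeasurableSet[𝒢] V ∧ P V ≠ 0 ∧
      ∀ ξ, π ξ ≤ Y → ∀ᵐ ω ∂P.restrict V, P[Z * ⇑ξ.1 | 𝒢] ω < P[Z * ⇑X.1 | 𝒢] ω := by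
  classical
  have hBΩ := h𝒢 B hB
  obtain ⟨x, hx, hπx⟩ := hREG.exists_piecewise hLF X η hB
  have hxY : ¬ π x ≤ Y := fun hle => by
    refine hPB (measure_eq_zero_iff_ae_notMem.2 ?_)
    filter_upwards [hπx, (ae_restrict_iff' hBΩ).1 hYX, AEEqFun.coeFn_le.2 hle]
      with ω hω hlt hωY hωB
    rw [hω, Set.piecewise_eq_of_mem _ _ _ hωB] at hωY
    exact (hlt hωB).not_ge hωY
  obtain ⟨Z, hZ, hZ0, V, hV, hPV, hsep⟩ :=
    exists_dualDensity_separating hLF hdual hMON hQCO hREG hLSC hη hxY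
  obtain ⟨hxX, hxη⟩ := condExp_mul_piecewise_ae_eq h𝒢 hZ.integrable_mul hB hx
  have hVB : V ≤ᵐ[P] B := by
    filter_upwards [(ae_restrict_iff' (h𝒢 V hV)).1 (hsep η hη),
      (ae_restrict_iff' hBΩ.compl).1 hxη] with ω hlt heq hωV
    by_contra hωB
    exact (hlt hωV).ne' (heq hωB)
  refine ⟨Z, hZ, hZ0, V ∩ B, Set.inter_subset_right, hV.inter hB, ?_, fun ξ hξ => ?_⟩
  · rwa [measure_congr (inter_eventuallyEq_left.2 hVB)]
  · filter_upwards [ae_restrict_of_ae_restrict_of_subset Set.inter_subset_left (hsep ξ hξ),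
      ae_restrict_of_ae_restrict_of_subset Set.inter_subset_right hxX] with ω hlt heq
    rwa [heq] at hlt

variable (hLG : ∀ f ∈ LG, AEStronglyMeasurable[𝒢] f P) (hne : (dualProbabilities 𝒢 LF).Nonempty)

include hLG hne

theorem exists_dualProbability_le_on (hη : π η ≤ Y) {B : Set Ω} (hB : MeasurableSet[𝒢] B)
    (hPB : P B ≠ 0) (hYX : ∀ᵐ ω ∂P.restrict B, Y.1 ω < (π X).1 ω) :
    ∃ D ⊆ B, MeasurableSet[𝒢] D ∧ P D ≠ 0 ∧ ∃ Q ∈ dualProbabilities 𝒢 LF, ∀ ξ : LF,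
      Q[X.1 | 𝒢] ≤ᵐ[Q] Q[ξ.1 | 𝒢] → Y.1 ≤ᵐ[P.restrict D] (π ξ).1 := by
  obtain ⟨Z, hZ, hZ0, V, hVB, hV, hPV, hsep⟩ :=
    exists_dualDensity_separating_on hLF hdual hMON hQCO hREG hLSC hη hB hPB hYX
  have hpos : ∀ᵐ ω ∂P.restrict V, 0 < P[Z | 𝒢] ω :=
    condExp_pos_of_condExp_mul_lt h𝒢 hZ.integrable hZ0 (hZ.integrable_mul η)
      (hZ.integrable_mul X) (hsep η hη)
  obtain ⟨c, hc, hPD⟩ := exists_pos_measure_inter_ne_zero (h𝒢 V hV) hPV hpos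
  let D : Set Ω := V ∩ {ω | c ≤ P[Z | 𝒢] ω}
  have hD : MeasurableSet[𝒢] D :=
    hV.inter (stronglyMeasurable_const.measurableSet_le stronglyMeasurable_condExp)
  obtain ⟨Q, hQ, hQZ⟩ :=
    hZ.exists_condExp_mul_eq h𝒢 hZ0 hne hD hc fun ω hω => hω.2
  refine ⟨D, Set.inter_subset_left.trans hVB, hD, hPD, Q, hQ, fun ξ hξ => ?_⟩
  have hξP : Q[X.1 | 𝒢] ≤ᵐ[P] Q[ξ.1 | 𝒢] :=
    ae_le_of_ae_le_of_trim_eq h𝒢 (trim_eq_trim_of_forall_measurableSet h𝒢 hQ.2.2.2)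
      stronglyMeasurable_condExp stronglyMeasurable_condExp hξ
  refine hREG.ae_le_of_condExp_mul_le hLF hLG hη hZ.integrable_mul hD
    (fun ζ hζ => ae_restrict_of_ae_restrict_of_subset Set.inter_subset_left (hsep ζ hζ)) ?_
  filter_upwards [hQZ X, hQZ ξ, ae_restrict_of_ae hξP, ae_restrict_mem (h𝒢 D hD)]
    with ω hωX hωξ hle hωD
  rw [hωX, hωξ]
  exact mul_le_mul_of_nonneg_left hle (hc.le.trans hωD.2)

theorem ae_le_esssup_K_of_map_le_of_lt_map (hη : π η ≤ Y) {A : Set Ω} (hA : MeasurableSet[𝒢] A)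
    (hYX : ∀ᵐ ω ∂P.restrict A, Y.1 ω < (π X).1 ω) :
    ∀ᵐ ω ∂P.restrict A,
      (Y.1 ω : EReal) ≤ esssup {k | ∃ Q ∈ dualProbabilities 𝒢 LF, k = K 𝒢 π X Q} ω := by
  refine ae_restrict_of_forall_exists_subset h𝒢 hA fun B hBA hB hPB => ?_
  obtain ⟨D, hDB, hD, hPD, Q, hQ, hQle⟩ :=
    exists_dualProbability_le_on hLF hdual hMON hQCO hREG hLSC hLG hne hη hB hPB
      (ae_restrict_of_ae_restrict_of_subset hBA hYX)
  exact ⟨D, hDB, hD, hPD, ae_le_esssup_K_of_forall_le hQ (h𝒢 D hD) hQle⟩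

theorem ae_map_le_esssup_K_of_map_lt {A : Set Ω} (hA : MeasurableSet[𝒢] A)
    (hηX : ∀ᵐ ω ∂P.restrict A, (π η).1 ω < (π X).1 ω) :
    ∀ᵐ ω ∂P.restrict A,
      ((π X).1 ω : EReal) ≤ esssup {k | ∃ Q ∈ dualProbabilities 𝒢 LF, k = K 𝒢 π X Q} ω := by
  classical
  obtain ⟨ζ, -, hζ⟩ := hREG.exists_piecewise hLF η X hA
  have hζη : ∀ᵐ ω ∂P.restrict A, (π ζ).1 ω = (π η).1 ω := by
    filter_upwards [ae_restrict_of_ae hζ, ae_restrict_mem (h𝒢 A hA)] with ω hω hωA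
    rw [hω, Set.piecewise_eq_of_mem _ _ _ hωA]
  have hζX : ∀ᵐ ω ∂P, (π ζ).1 ω ≤ (π X).1 ω := by
    filter_upwards [hζ, (ae_restrict_iff' (h𝒢 A hA)).1 hηX] with ω hω hlt
    by_cases hωA : ω ∈ A
    · simpa only [hω, Set.piecewise_eq_of_mem _ _ _ hωA] using (hlt hωA).le
    · simp only [hω, Set.piecewise_eq_of_notMem _ _ _ hωA, le_refl]
  refine ae_le_of_forall_nat_ae_convexComb_le (g := (π ζ).1) fun n => ?_
  let t : ℝ := 1 / ((n : ℝ) + 1)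
  have ht : 0 < t := Nat.one_div_pos_of_nat
  have ht1 : t ≤ 1 := div_le_one_of_le₀ (by linarith [n.cast_nonneg (α := ℝ)]) (by positivity)
  have hY : (π X + t • (π ζ - π X)).1 =ᵐ[P] fun ω => (π X).1 ω + t * ((π ζ).1 ω - (π X).1 ω) :=
    coeFn_add_smul_sub _ _ _
  have hζY : π ζ ≤ π X + t • (π ζ - π X) := by
    refine AEEqFun.coeFn_le.1 ?_
    filter_upwards [hY, hζX] with ω hω hle
    rw [hω]
    nlinarith
  have hYX : ∀ᵐ ω ∂P.restrict A, (π X + t • (π ζ - π X)).1 ω < (π X).1 ω := by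
    filter_upwards [ae_restrict_of_ae hY, hζη, hηX] with ω hω heq hlt
    rw [hω, heq]
    nlinarith
  filter_upwards [ae_restrict_of_ae hY,
    ae_le_esssup_K_of_map_le_of_lt_map hLF hdual hMON hQCO hREG hLSC hLG hne hζY hA hYX]
    with ω hω hle
  rwa [hω] at hle

theorem ae_map_le_esssup_K :
    ∀ᵐ ω ∂P,
      ((π X).1 ω : EReal) ≤ esssup {k | ∃ Q ∈ dualProbabilities 𝒢 LF, k = K 𝒢 π X Q} ω := by
  suffices h : ∀ᵐ ω ∂P.restrict Set.univ,
      ((π X).1 ω : EReal) ≤ esssup {k | ∃ Q ∈ dualProbabilities 𝒢 LF, k = K 𝒢 π X Q} ω by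
    simpa only [Measure.restrict_univ] using h
  refine ae_restrict_of_forall_exists_subset h𝒢 MeasurableSet.univ fun B _ hB hPB => ?_
  by_cases hmin : ∀ ξ, (π X).1 ≤ᵐ[P.restrict B] (π ξ).1
  · obtain ⟨Q, hQ⟩ := hne
    exact ⟨B, subset_rfl, hB, hPB, ae_le_esssup_K_of_forall_le hQ (h𝒢 B hB) fun ξ _ => hmin ξ⟩
  · push Not at hmin
    obtain ⟨ξ, hξ⟩ := hmin
    obtain ⟨A, hA, hAlt⟩ := exists_measurableSet_ae_mem_iff_lt (hLG _ (π ξ).2) (hLG _ (π X).2)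
    have hPBA : P (B ∩ A) ≠ 0 := fun hnull => hξ <| (ae_restrict_iff' (h𝒢 B hB)).2 <| by
      filter_upwards [measure_eq_zero_iff_ae_notMem.1 hnull, hAlt] with ω hω hωA hωB
      exact not_lt.1 fun hlt => hω ⟨hωB, hωA.2 hlt⟩
    have hξX : ∀ᵐ ω ∂P.restrict (B ∩ A), (π ξ).1 ω < (π X).1 ω := by
      filter_upwards [ae_restrict_of_ae hAlt, ae_restrict_mem (h𝒢 _ (hB.inter hA))] with ω hωA hω
      exact hωA.1 hω.2
    exact ⟨B ∩ A, Set.inter_subset_left, hB.inter hA, hPBA,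
      ae_map_le_esssup_K_of_map_lt hLF hdual hMON hQCO hREG hLSC hLG hne (hB.inter hA) hξX⟩

end Separation

end LocalDuality

end QuasiconvexDual

open QuasiconvexDual in
theorem mainTheorem2_general {Ω : Type*} (𝒢 : MeasurableSpace Ω) [mΩ : MeasurableSpace Ω]
    (h𝒢 : 𝒢 ≤ mΩ) (P : Measure Ω) [IsProbabilityMeasure P]
    (LF LG : Submodule ℝ (Ω →ₘ[P] ℝ))
    (hLF : IsRandomLattice mΩ le_rfl LF) (hLG : ∀ f ∈ LG, AEStronglyMeasurable[𝒢] f P)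
    (hdual : ∀ φ ∈ orderContinuousDual LF, ∃ Z : Ω → ℝ, Represents LF Z φ)
    (hne : (dualProbabilities 𝒢 LF).Nonempty)
    (π : LF → LG) (hMON : Monotone π) (hQCO : QuasiconvexOn ℝ Set.univ π)
    (hREG : IsRegular 𝒢 h𝒢 π) (hLSC : IsWeakLSC π) (X : LF) :
    toEReal (π X : Ω →ₘ[P] ℝ) = esssup {k | ∃ Q ∈ dualProbabilities 𝒢 LF, k = K 𝒢 π X Q} := by
  apply le_antisymm
  · refine AEEqFun.coeFn_le.1 ?_
    filter_upwards [coeFn_toEReal (π X).1,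
      ae_map_le_esssup_K (X := X) hLF hdual hMON hQCO hREG hLSC hLG hne] with ω hω hle
    rwa [hω]
  · refine (isLUB_esssup _).2 ?_
    rintro _ ⟨Q, -, rfl⟩
    exact (isGLB_essinf _).1 ⟨X, EventuallyLE.refl _ _, rfl⟩

open QuasiconvexDual in
theorem mainTheorem2 {Ω : Type*} (𝒢 : MeasurableSpace Ω) [mΩ : MeasurableSpace Ω]
    (h𝒢 : 𝒢 ≤ mΩ) (P : Measure Ω) [IsProbabilityMeasure P]
    (LF LG : Submodule ℝ (Ω →ₘ[P] ℝ))
    (hLF : IsRandomLattice mΩ le_rfl LF) (hLG : IsRandomLattice 𝒢 h𝒢 LG)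
    (hdual : ∀ φ ∈ orderContinuousDual LF, ∃ Z : Ω → ℝ, Represents LF Z φ)
    (hdual_ind : ∀ Z : Ω → ℝ, IsDualDensity LF Z →
      ∀ A : Set Ω, MeasurableSet A → IsDualDensity LF (A.indicator Z))
    (hsep : ∀ ξ : LF, (∀ φ ∈ orderContinuousDual LF, φ ξ = 0) → ξ = 0)
    (hne : (dualProbabilities 𝒢 LF).Nonempty)
    (π : LF → LG) (hMON : Monotone π) (hQCO : IsCondQuasiconvex 𝒢 π)
    (hREG : IsRegular 𝒢 h𝒢 π) (hLSC : IsWeakLSC π)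
    (X : LF)
    (hX : ∃ (η : LF) (δ : ℝ), 0 < δ ∧
      ∀ᵐ ω ∂P, (π η : Ω →ₘ[P] ℝ) ω + δ < (π X : Ω →ₘ[P] ℝ) ω) :
    toEReal (π X : Ω →ₘ[P] ℝ) = esssup {k | ∃ Q ∈ dualProbabilities 𝒢 LF, k = K 𝒢 π X Q} := by
  exact mainTheorem2_general 𝒢 h𝒢 P LF LG hLF hLG.measurable hdual hne π hMON
    hQCO.quasiconvexOn hREG hLSC X
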